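/- Let $B$ be a unital C*-algebra, let $m,k$ be natural numbers, and let $\Sigma=\{\sigma_{a|x}\}_{a=1,\dots,k;\ x=1,\dots,m}$ be a collection of positive linear functionals on $B$. For a unital C*-algebra $A$ let $A\otimes_{max}B$ denote the maximal C*-tensor product and $S(A\otimes_{max}B)$ its set of states (positive linear functionals $\phi$ with $\phi(\mathbf 1)=1$). Let $C^*(m,k)$ be the universal unital C*-algebra generated by elements $P_{a|x}$ ($a=1,\dots,k$, $x=1,\dots,m$) subject to the relations $P_{a|x}=P_{a|x}^*=P_{a|x}^2$ for all $a,x$ and $\sum_{a}P_{a|x}=\mathbf 1$ for all $x$. Then the following conditions are equivalent: 1. there is a state $\phi\in S(C^*(m,k)\otimes_{max}B)$ such that $\sigma_{a|x}(b)=\phi(P_{a|x}\otimes b)$ for all $a,x$ and all $b\in B$, where $P_{a|x}$ are the generating projections of $C^*(m,k)$; 2. there are a unital C*-algebra $A$, projections $P_{a|x}=P_{a|x}^*=P_{a|x}^2\in A$ with $\sum_a P_{a|x}=\mathbf 1$ for every $x$ (PVM elements), and a state $\phi\in S(A\otimes_{max}B)$ such that $\sigma_{a|x}(b)=\phi(P_{a|x}\otimes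 b)$ for all $a,x$ and all $b\in B$; 3. there are a unital C*-algebra $A$, positive elements $M_{a|x}\in A$ with $\sum_a M_{a|x}=\mathbf 1$ for every $x$ (POVM elements), and a state $\phi\in S(A\otimes_{max}B)$ such that $\sigma_{a|x}(b)=\phi(M_{a|x}\otimes b)$ for all $a,x$ and all $b\in B$. -/

import Mathlib

open scoped TensorProduct ComplexOrder

universe u v

/-! ### C⋆-seminorms on complex ⋆-algebras and their completions -/

/-- A C⋆-seminorm on a unital complex ⋆-algebra: a submultiplicative seminorm satisfying the
C⋆-identity `p (x⋆ x) = p x ^ 2`. -/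
structure CStarSeminorm (R : Type*) [Ring R] [StarRing R] [Algebra ℂ R] [StarModule ℂ R]
    extends Seminorm ℂ R where
  mul_le' : ∀ x y : R, toFun (x * y) ≤ toFun x * toFun y
  star_mul_self' : ∀ x : R, toFun (star x * x) = toFun x ^ 2

namespace CStarSeminorm

section Basic

variable {R : Type*} [Ring R] [StarRing R] [Algebra ℂ R] [StarModule ℂ R]

instance : FunLike (CStarSeminorm R) R ℝ where
  coe p := p.toFun
  coe_injective p q h := by
    cases p; cases q; congr; exact DFunLike.coe_injective h

variable (p : CStarSeminorm R)

theorem map_zero : p 0 = 0 := p.map_zero'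
theorem nonneg (x : R) : 0 ≤ p x := apply_nonneg p.toSeminorm x
theorem add_le (x y : R) : p (x + y) ≤ p x + p y := p.add_le' x y
theorem map_neg (x : R) : p (-x) = p x := p.neg' x
theorem map_smul (c : ℂ) (x : R) : p (c • x) = ‖c‖ * p x := p.smul' c x
theorem mul_le (x y : R) : p (x * y) ≤ p x * p y := p.mul_le' x y
theorem star_mul_self (x : R) : p (star x * x) = p x ^ 2 := p.star_mul_self' x

theorem le_star (x : R) : p x ≤ p (star x) := by
  rcases (p.nonneg x).eq_or_lt with h | h
  · rw [← h]; exact p.nonneg _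
  · have h1 := p.mul_le (star x) x
    rw [p.star_mul_self, sq] at h1
    exact le_of_mul_le_mul_right h1 h

theorem map_star (x : R) : p (star x) = p x :=
  le_antisymm (by simpa using p.le_star (star x)) (p.le_star x)

/-- A projection has C⋆-seminorm at most one. -/
theorem le_one_of_proj {x : R} (h : p (star x * x) = p x) : p x ≤ 1 := by
  rw [p.star_mul_self] at h
  by_contra! h1
  nlinarith

theorem map_one_le : p 1 ≤ 1 := p.le_one_of_proj (by simp)

/-- A copy of the ⋆-algebra `R`, carrying the seminorm `p`. -/
def Pre (_p : CStarSeminorm R) : Type _ := R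

namespace Pre

instance : Ring p.Pre := inferInstanceAs (Ring R)
instance : StarRing p.Pre := inferInstanceAs (StarRing R)
instance : Algebra ℂ p.Pre := inferInstanceAs (Algebra ℂ R)
instance : StarModule ℂ p.Pre := inferInstanceAs (StarModule ℂ R)

/-- The identity map from `R` to its copy carrying the seminorm `p`. -/
def of : R ≃⋆ₐ[ℂ] p.Pre := StarAlgEquiv.refl ℂ R

instance : SeminormedAddCommGroup p.Pre :=
  AddGroupSeminorm.toSeminormedAddCommGroup (E := p.Pre) p.toSeminorm.toAddGroupSeminorm

theorem norm_of (x : R) : ‖of p x‖ = p x := rfl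

theorem norm_def (x : p.Pre) : ‖x‖ = p ((of p).symm x) := rfl

noncomputable instance : SeminormedRing p.Pre where
  __ := (inferInstance : Ring p.Pre)
  __ := (inferInstance : SeminormedAddCommGroup p.Pre)
  norm_mul_le x y := p.mul_le x y

noncomputable instance : NormedAlgebra ℂ p.Pre where
  __ := (inferInstance : Algebra ℂ p.Pre)
  norm_smul_le c x := (p.map_smul c x).le

instance : NormedStarGroup p.Pre where
  norm_star_le x := (p.map_star x).le

end Pre

/-- The Hausdorff completion of a unital complex ⋆-algebra with respect to a C⋆-seminorm. -/
abbrev CStarCompletion : Type _ := UniformSpace.Completion p.Pre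

namespace CStarCompletion

open UniformSpace

theorem uniformContinuous_star : UniformContinuous (star : p.Pre → p.Pre) :=
  (LipschitzWith.mk_one fun x y => by
    rw [dist_eq_norm, dist_eq_norm, ← star_sub, norm_star]).uniformContinuous

noncomputable instance : Star p.CStarCompletion := ⟨Completion.map star⟩

theorem coe_star (x : p.Pre) : ((star x : p.Pre) : p.CStarCompletion) = star (x : p.CStarCompletion) :=
  (Completion.map_coe (uniformContinuous_star p) x).symm

theorem continuous_star : Continuous (star : p.CStarCompletion → p.CStarCompletion) :=
  Completion.continuous_map

noncomputable instance : StarRing p.CStarCompletion where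
  star_involutive x := by
    induction x using Completion.induction_on with
    | hp => exact isClosed_eq ((continuous_star p).comp (continuous_star p)) continuous_id
    | ih x => rw [← coe_star, ← coe_star, star_star]
  star_mul x y := by
    induction x, y using Completion.induction_on₂ with
    | hp =>
      exact isClosed_eq ((continuous_star p).comp continuous_mul)
        (((continuous_star p).comp continuous_snd).mul ((continuous_star p).comp continuous_fst))
    | ih x y =>
      rw [← Completion.coe_mul, ← coe_star, ← coe_star, ← coe_star, ← Completion.coe_mul, star_mul]
  star_add x y := by
    induction x, y using Completion.induction_on₂ with
    | hp =>
      exact isClosed_eq ((continuous_star p).comp continuous_add)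
        (((continuous_star p).comp continuous_fst).add ((continuous_star p).comp continuous_snd))
    | ih x y =>
      rw [← Completion.coe_add, ← coe_star, ← coe_star, ← coe_star, ← Completion.coe_add, star_add]

noncomputable instance : CStarAlgebra p.CStarCompletion where
  __ := (inferInstance : NormedRing p.CStarCompletion)
  __ := (inferInstance : StarRing p.CStarCompletion)
  __ := (inferInstance : CompleteSpace p.CStarCompletion)
  __ := (inferInstance : Algebra ℂ p.CStarCompletion)
  norm_smul_le c x := norm_smul_le c x
  star_smul c x := by
    induction x using Completion.induction_on with
    | hp =>
      exact isClosed_eq ((continuous_star p).comp (continuous_const_smul c))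
        ((continuous_star p).const_smul (star c))
    | ih x =>
      rw [← Completion.coe_smul, ← coe_star, ← coe_star, ← Completion.coe_smul, star_smul]
  norm_mul_self_le x := by
    induction x using Completion.induction_on with
    | hp =>
      exact isClosed_le (continuous_norm.mul continuous_norm)
        (continuous_norm.comp ((continuous_star p).mul continuous_id))
    | ih x =>
      rw [← coe_star, ← Completion.coe_mul, Completion.norm_coe, Completion.norm_coe, ← sq]
      exact (p.star_mul_self x).ge

noncomputable instance : PartialOrder p.CStarCompletion := CStarAlgebra.spectralOrder _

instance : StarOrderedRing p.CStarCompletion := CStarAlgebra.spectralOrderedRing _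

end CStarCompletion

/-- The canonical unital ⋆-homomorphism from a ⋆-algebra into its completion. -/
noncomputable def toCompletion : R →⋆ₐ[ℂ] p.CStarCompletion where
  toFun x := ((Pre.of p x : p.Pre) : p.CStarCompletion)
  map_one' := rfl
  map_mul' x y := UniformSpace.Completion.coe_mul (Pre.of p x) (Pre.of p y)
  map_zero' := rfl
  map_add' x y := UniformSpace.Completion.coe_add (Pre.of p x) (Pre.of p y)
  commutes' _ := rfl
  map_star' x := CStarCompletion.coe_star p (Pre.of p x)

theorem norm_toCompletion (x : R) : ‖p.toCompletion x‖ = p x :=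
  UniformSpace.Completion.norm_coe (Pre.of p x)

/-- The pointwise supremum of a pointwise bounded family of C⋆-seminorms. -/
noncomputable def sup (S : Set (CStarSeminorm R))
    (hS : ∀ x : R, BddAbove (Set.range fun p : S => p.1 x)) : CStarSeminorm R where
  toFun x := ⨆ p : S, p.1 x
  map_zero' := by simp [CStarSeminorm.map_zero]
  add_le' x y := Real.iSup_le
    (fun p => (p.1.add_le x y).trans (add_le_add (le_ciSup (hS x) p) (le_ciSup (hS y) p)))
    (add_nonneg (Real.iSup_nonneg fun p => p.1.nonneg x) (Real.iSup_nonneg fun p => p.1.nonneg y))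
  neg' x := by simp [CStarSeminorm.map_neg]
  smul' c x := by simp only [CStarSeminorm.map_smul, Real.mul_iSup_of_nonneg (norm_nonneg c)]
  mul_le' x y := Real.iSup_le
    (fun p => (p.1.mul_le x y).trans
      (mul_le_mul (le_ciSup (hS x) p) (le_ciSup (hS y) p) (p.1.nonneg y)
        (Real.iSup_nonneg fun p => p.1.nonneg x)))
    (mul_nonneg (Real.iSup_nonneg fun p => p.1.nonneg x) (Real.iSup_nonneg fun p => p.1.nonneg y))
  star_mul_self' x := by
    simp only [CStarSeminorm.star_mul_self]
    rcases isEmpty_or_nonempty S with h | h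
    · simp
    exact (Real.iSup_pow (fun p => p.1.nonneg x) 2).symm

theorem sup_apply (S : Set (CStarSeminorm R))
    (hS : ∀ x : R, BddAbove (Set.range fun p : S => p.1 x)) (x : R) :
    sup S hS x = ⨆ p : S, p.1 x := rfl

end Basic

end CStarSeminorm

/-! ### The maximal tensor product -/

section MaxTensor

variable (A B : Type*) [CStarAlgebra A] [CStarAlgebra B]

theorem cstarSeminorm_tensor_bddAbove (x : A ⊗[ℂ] B) :
    BddAbove (Set.range fun p : (Set.univ : Set (CStarSeminorm (A ⊗[ℂ] B))) => p.1 x) := by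
  induction x using TensorProduct.induction_on with
  | zero => exact ⟨0, by rintro _ ⟨p, rfl⟩; exact p.1.map_zero.le⟩
  | tmul a b =>
    refine ⟨‖a‖ * ‖b‖, ?_⟩
    rintro _ ⟨⟨p, -⟩, rfl⟩
    let f : A →⋆ₐ[ℂ] p.CStarCompletion :=
      { p.toCompletion.toAlgHom.comp
          (Algebra.TensorProduct.includeLeft : A →ₐ[ℂ] A ⊗[ℂ] B) with
        map_star' := fun a => by
          change p.toCompletion (star a ⊗ₜ 1) = star (p.toCompletion (a ⊗ₜ 1))
          rw [← map_star]; simp }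
    let g : B →⋆ₐ[ℂ] p.CStarCompletion :=
      { p.toCompletion.toAlgHom.comp
          (Algebra.TensorProduct.includeRight : B →ₐ[ℂ] A ⊗[ℂ] B) with
        map_star' := fun b => by
          change p.toCompletion (1 ⊗ₜ star b) = star (p.toCompletion (1 ⊗ₜ b))
          rw [← map_star]; simp }
    have hf : p (a ⊗ₜ 1) ≤ ‖a‖ := by
      rw [← p.norm_toCompletion]; exact NonUnitalStarAlgHom.norm_apply_le f a
    have hg : p (1 ⊗ₜ b) ≤ ‖b‖ := by
      rw [← p.norm_toCompletion]; exact NonUnitalStarAlgHom.norm_apply_le g b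
    have h := p.mul_le (a ⊗ₜ 1) (1 ⊗ₜ b)
    rw [Algebra.TensorProduct.tmul_mul_tmul, mul_one, one_mul] at h
    exact h.trans (mul_le_mul hf hg (p.nonneg _) (norm_nonneg _))
  | add x y hx hy =>
    obtain ⟨C, hC⟩ := hx
    obtain ⟨D, hD⟩ := hy
    refine ⟨C + D, ?_⟩
    rintro _ ⟨p, rfl⟩
    exact (p.1.add_le x y).trans (add_le_add (hC ⟨p, rfl⟩) (hD ⟨p, rfl⟩))

/-- The maximal C⋆-norm on the algebraic tensor product: the supremum of all C⋆-seminorms. -/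
noncomputable def maxCStarSeminorm : CStarSeminorm (A ⊗[ℂ] B) :=
  CStarSeminorm.sup Set.univ (cstarSeminorm_tensor_bddAbove A B)

/-- The maximal tensor product of two unital C⋆-algebras. -/
abbrev MaxTensor : Type _ := (maxCStarSeminorm A B).CStarCompletion

variable {A B}

/-- The elementary tensor `a ⊗ b`, as an element of the maximal tensor product. -/
noncomputable def MaxTensor.tmul (a : A) (b : B) : MaxTensor A B :=
  (maxCStarSeminorm A B).toCompletion (a ⊗ₜ[ℂ] b)

end MaxTensor

/-! ### Measurements and the universal C⋆-algebra generated by them -/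

/-- `P a x` (outcome `a`, setting `x`) are the elements of `m` projection-valued measures with
`k` outcomes. -/
structure IsPVMFamily {A : Type*} [CStarAlgebra A] {m k : ℕ} (P : Fin k → Fin m → A) : Prop where
  isStarProjection : ∀ a x, IsStarProjection (P a x)
  sum_eq_one : ∀ x, ∑ a, P a x = 1

/-- `M a x` (outcome `a`, setting `x`) are the elements of `m` positive operator-valued measures
with `k` outcomes. -/
structure IsPOVMFamily {A : Type*} [CStarAlgebra A] [PartialOrder A] [StarOrderedRing A] {m k : ℕ}
    (M : Fin k → Fin m → A) : Prop where
  nonneg : ∀ a x, 0 ≤ M a x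
  sum_eq_one : ∀ x, ∑ a, M a x = 1

section Universal

variable (m k : ℕ)

/-- The free unital complex ⋆-algebra on self-adjoint generators `p a x`, as the complexification
of the free real algebra (whose involution reverses words). -/
abbrev FreeMeasurementAlgebra : Type := ℂ ⊗[ℝ] FreeAlgebra ℝ (Fin k × Fin m)

instance (X : Type*) : StarModule ℝ (FreeAlgebra ℝ X) where
  star_smul r x := by
    rw [Algebra.smul_def, star_mul, FreeAlgebra.star_algebraMap, star_trivial r,
      ← Algebra.commutes, ← Algebra.smul_def]

instance : StarModule ℂ (FreeMeasurementAlgebra m k) where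
  star_smul c x := by
    induction x using TensorProduct.induction_on with
    | zero => simp
    | tmul z w => simp [TensorProduct.smul_tmul']
    | add x y hx hy => rw [smul_add, star_add, hx, hy, star_add, smul_add]

variable {m k} in
/-- The free self-adjoint generators. -/
noncomputable def freeGenerator (a : Fin k) (x : Fin m) : FreeMeasurementAlgebra m k :=
  1 ⊗ₜ FreeAlgebra.ι ℝ (a, x)

/-- The C⋆-seminorms compatible with the defining relations `p a x = (p a x) ^ 2` and
`∑ a, p a x = 1`. -/
def measurementSeminorms : Set (CStarSeminorm (FreeMeasurementAlgebra m k)) :=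
  {p | (∀ a x, p (freeGenerator a x * freeGenerator a x - freeGenerator a x) = 0) ∧
    ∀ x, p (∑ a, freeGenerator a x - 1) = 0}

theorem measurementSeminorms_bddAbove (y : FreeMeasurementAlgebra m k) :
    BddAbove (Set.range fun p : measurementSeminorms m k => p.1 y) := by
  have hadd : ∀ y z : FreeMeasurementAlgebra m k,
      BddAbove (Set.range fun p : measurementSeminorms m k => p.1 y) →
      BddAbove (Set.range fun p : measurementSeminorms m k => p.1 z) →
      BddAbove (Set.range fun p : measurementSeminorms m k => p.1 (y + z)) := by
    rintro y z ⟨C, hC⟩ ⟨D, hD⟩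
    refine ⟨C + D, ?_⟩
    rintro _ ⟨p, rfl⟩
    exact (p.1.add_le y z).trans (add_le_add (hC ⟨p, rfl⟩) (hD ⟨p, rfl⟩))
  have hmul : ∀ y z : FreeMeasurementAlgebra m k,
      BddAbove (Set.range fun p : measurementSeminorms m k => p.1 y) →
      BddAbove (Set.range fun p : measurementSeminorms m k => p.1 z) →
      BddAbove (Set.range fun p : measurementSeminorms m k => p.1 (y * z)) := by
    rintro y z ⟨C, hC⟩ ⟨D, hD⟩
    refine ⟨C * D, ?_⟩
    rintro _ ⟨p, rfl⟩
    exact (p.1.mul_le y z).trans (mul_le_mul (hC ⟨p, rfl⟩) (hD ⟨p, rfl⟩) (p.1.nonneg _)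
      ((p.1.nonneg _).trans (hC ⟨p, rfl⟩)))
  have hscal : ∀ c : ℂ, BddAbove (Set.range fun p : measurementSeminorms m k =>
      p.1 (c • (1 : FreeMeasurementAlgebra m k))) := by
    intro c
    refine ⟨‖c‖, ?_⟩
    rintro _ ⟨p, rfl⟩
    change p.1 _ ≤ _
    rw [p.1.map_smul]
    exact mul_le_of_le_one_right (norm_nonneg _) p.1.map_one_le
  induction y using TensorProduct.induction_on with
  | zero => simpa using hscal 0
  | add y z hy hz => exact hadd y z hy hz
  | tmul c w =>
    have h : c ⊗ₜ[ℝ] w = (c • (1 : FreeMeasurementAlgebra m k)) * (1 ⊗ₜ w) := by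
      simp [Algebra.TensorProduct.one_def, TensorProduct.smul_tmul']
    rw [h]
    refine hmul _ _ (hscal c) ?_
    clear h
    induction w using FreeAlgebra.induction with
    | grade0 r =>
      have h : (1 : ℂ) ⊗ₜ[ℝ] algebraMap ℝ (FreeAlgebra ℝ (Fin k × Fin m)) r =
          (r : ℂ) • (1 : FreeMeasurementAlgebra m k) := by
        rw [Algebra.algebraMap_eq_smul_one, ← TensorProduct.smul_tmul]
        simp [Algebra.TensorProduct.one_def, TensorProduct.smul_tmul']
      rw [h]
      exact hscal r
    | grade1 i =>
      obtain ⟨a, x⟩ := i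
      refine ⟨1, ?_⟩
      rintro _ ⟨⟨p, hp⟩, rfl⟩
      refine p.le_one_of_proj (x := freeGenerator a x) ?_
      have hs : star (freeGenerator a x : FreeMeasurementAlgebra m k) = freeGenerator a x := by
        simp [freeGenerator]
      rw [hs]
      have h0 := hp.1 a x
      have h1 := p.add_le (freeGenerator a x * freeGenerator a x - freeGenerator a x)
        (freeGenerator a x)
      have h2 := p.add_le (-(freeGenerator a x * freeGenerator a x - freeGenerator a x))
        (freeGenerator a x * freeGenerator a x)
      rw [p.map_neg, neg_sub, sub_add_cancel, h0, zero_add] at h2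
      rw [sub_add_cancel, h0, zero_add] at h1
      exact le_antisymm h1 h2
    | mul u v hu hv =>
      have h : (1 : ℂ) ⊗ₜ[ℝ] (u * v) = ((1 ⊗ₜ u) * (1 ⊗ₜ v) : FreeMeasurementAlgebra m k) := by
        simp
      rw [h]
      exact hmul _ _ hu hv
    | add u v hu hv =>
      rw [TensorProduct.tmul_add]
      exact hadd _ _ hu hv

/-- The largest C⋆-seminorm on the free ⋆-algebra compatible with the defining relations. -/
noncomputable def universalSeminorm : CStarSeminorm (FreeMeasurementAlgebra m k) :=
  CStarSeminorm.sup (measurementSeminorms m k) (measurementSeminorms_bddAbove m k)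

/-- `C⋆(m,k)`: the universal unital C⋆-algebra with generators `P a x` and relations
`P a x = (P a x)⋆ = (P a x) ^ 2`, `∑ a, P a x = 1`. -/
abbrev UniversalPVMAlgebra : Type := (universalSeminorm m k).CStarCompletion

variable {m k} in
/-- The generating projections of `C⋆(m,k)`. -/
noncomputable def generatingProjection (a : Fin k) (x : Fin m) : UniversalPVMAlgebra m k :=
  (universalSeminorm m k).toCompletion (freeGenerator a x)

end Universal

/-! ### States -/

/-- A state on a unital C⋆-algebra: a normalized positive functional. -/
def IsState {A : Type*} [CStarAlgebra A] [PartialOrder A] [StarOrderedRing A]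
    (φ : A →ₚ[ℂ] ℂ) : Prop :=
  φ 1 = 1

/-! The substance is that POVMs can be replaced by PVMs and that PVMs factor through `C⋆(m,k)`.

POVM to PVM is Naimark dilation. For a fixed setting put `s a = √(M a)`. Since `∑ a, s a ^ 2 = 1`,
the column `s` is an isometry, and it completes to a self-adjoint unitary `U` over `A` with one
extra index `none`. Conjugating diagonal projections by `U` gives a PVM whose `(none, none)` entries
are the `M a` (`exists_naimark_dilation`). The matrix size and the corner do not depend on the
setting, so a single functional serves all settings: map `Mₙ(A) ⊗ B` to `Mₙ(A ⊗ B)`, take the corner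
entry and apply `φ`. Taking the corner is not multiplicative, but it is positive and unital, so the
result is a state (`MaxTensor.exists_state_matrix`).

PVM to `C⋆(m,k)`: the universal property gives a ⋆-homomorphism `f` sending generators to the given
projections (`IsPVMFamily.exists_hom`), and the state is pulled back along `f ⊗ id`
(`MaxTensor.exists_state_comp_mapLeft`). Both universal properties rest on one fact: `x ↦ ‖F x‖` is
a C⋆-seminorm, hence lies below the supremum defining the completion.

The remaining implications are formal: projections are positive, and `C⋆(m,k)` is itself an
admissible algebra once moved to the required universe. -/

namespace CStarSeminorm

/-! ### Extending ⋆-homomorphisms to completions -/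

section Lift

variable {R D : Type*} [Ring R] [StarRing R] [Algebra ℂ R] [StarModule ℂ R] [CStarAlgebra D]

/-- The C⋆-seminorm pulled back from a C⋆-algebra along a ⋆-homomorphism. -/
noncomputable def ofHom (f : R →⋆ₐ[ℂ] D) : CStarSeminorm R where
  toFun x := ‖f x‖
  map_zero' := by simp
  add_le' x y := by rw [_root_.map_add]; exact norm_add_le _ _
  neg' x := by rw [_root_.map_neg, norm_neg]
  smul' c x := by rw [_root_.map_smul, norm_smul]
  mul_le' x y := by rw [_root_.map_mul]; exact norm_mul_le _ _
  star_mul_self' x := by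
    rw [_root_.map_mul, StarHomClass.map_star, CStarRing.norm_star_mul_self, sq]

theorem ofHom_apply (f : R →⋆ₐ[ℂ] D) (x : R) : ofHom f x = ‖f x‖ := rfl

theorem le_sup {S : Set (CStarSeminorm R)}
    (hS : ∀ x : R, BddAbove (Set.range fun p : S => p.1 x)) {q : CStarSeminorm R} (hq : q ∈ S)
    (x : R) : q x ≤ sup S hS x :=
  le_ciSup (hS x) (⟨q, hq⟩ : S)

variable (p : CStarSeminorm R)

/-- A ⋆-homomorphism dominated by a C⋆-seminorm extends to the completion. -/
noncomputable def lift (f : R →⋆ₐ[ℂ] D) (hf : ∀ x, ‖f x‖ ≤ p x) : p.CStarCompletion →⋆ₐ[ℂ] D :=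
  let g : p.Pre →+* D := (f : R →+* D)
  have hg : Continuous g :=
    AddMonoidHomClass.continuous_of_bound g 1 fun x => by rw [one_mul]; exact hf x
  { UniformSpace.Completion.extensionHom g hg with
    commutes' c :=
      (UniformSpace.Completion.extensionHom_coe g hg (algebraMap ℂ p.Pre c)).trans
        (AlgHomClass.commutes f c)
    map_star' x := by
      change UniformSpace.Completion.extensionHom g hg (star x) =
        star (UniformSpace.Completion.extensionHom g hg x)
      have hc : Continuous (UniformSpace.Completion.extensionHom g hg) :=
        UniformSpace.Completion.continuous_extension
      induction x using UniformSpace.Completion.induction_on with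
      | hp =>
        exact isClosed_eq (hc.comp (CStarCompletion.continuous_star p))
          (ContinuousStar.continuous_star.comp hc)
      | ih x =>
        rw [← CStarCompletion.coe_star, UniformSpace.Completion.extensionHom_coe,
          UniformSpace.Completion.extensionHom_coe]
        exact StarHomClass.map_star f x }

theorem lift_toCompletion (f : R →⋆ₐ[ℂ] D) (hf : ∀ x, ‖f x‖ ≤ p x) (x : R) :
    p.lift f hf (p.toCompletion x) = f x :=
  let g : p.Pre →+* D := (f : R →+* D)
  have hg : Continuous g :=
    AddMonoidHomClass.continuous_of_bound g 1 fun x => by rw [one_mul]; exact hf x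
  UniformSpace.Completion.extensionHom_coe g hg (Pre.of p x)

end Lift

end CStarSeminorm

/-! ### Universal property and functoriality of the maximal tensor product -/

namespace MaxTensor

variable {A A' B D : Type*} [CStarAlgebra A] [CStarAlgebra A'] [CStarAlgebra B] [CStarAlgebra D]

/-- Two ⋆-homomorphisms with commuting ranges combine to a ⋆-homomorphism on the algebraic
tensor product. -/
noncomputable def algLift (f : A →⋆ₐ[ℂ] D) (g : B →⋆ₐ[ℂ] D) (h : ∀ a b, Commute (f a) (g b)) :
    A ⊗[ℂ] B →⋆ₐ[ℂ] D :=
  { Algebra.TensorProduct.lift (f : A →ₐ[ℂ] D) (g : B →ₐ[ℂ] D) h with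
    map_star' := fun x => by
      change Algebra.TensorProduct.lift (f : A →ₐ[ℂ] D) (g : B →ₐ[ℂ] D) h (star x) =
        star (Algebra.TensorProduct.lift (f : A →ₐ[ℂ] D) (g : B →ₐ[ℂ] D) h x)
      induction x using TensorProduct.induction_on with
      | zero => simp
      | tmul a b =>
        rw [TensorProduct.star_tmul, Algebra.TensorProduct.lift_tmul,
          Algebra.TensorProduct.lift_tmul, star_mul]
        -- The involution reverses the product `f a * g b`; commuting ranges restore the order.
        exact (h (star a) (star b)).eq.trans
          (congrArg₂ (· * ·) (StarHomClass.map_star g b) (StarHomClass.map_star f a))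
      | add x y hx hy => rw [star_add, map_add, hx, hy, map_add, star_add] }

/-- The seminorm pulled back along `F` is one of those in the supremum. -/
theorem norm_le_maxCStarSeminorm (F : A ⊗[ℂ] B →⋆ₐ[ℂ] D) (x : A ⊗[ℂ] B) :
    ‖F x‖ ≤ maxCStarSeminorm A B x :=
  CStarSeminorm.le_sup (cstarSeminorm_tensor_bddAbove A B)
    (Set.mem_univ (CStarSeminorm.ofHom F)) x

/-- The universal property of the maximal tensor product: ⋆-homomorphisms with commuting ranges
combine to a ⋆-homomorphism. -/
noncomputable def lift (f : A →⋆ₐ[ℂ] D) (g : B →⋆ₐ[ℂ] D) (h : ∀ a b, Commute (f a) (g b)) :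
    MaxTensor A B →⋆ₐ[ℂ] D :=
  (maxCStarSeminorm A B).lift (algLift f g h) (norm_le_maxCStarSeminorm _)

theorem lift_tmul (f : A →⋆ₐ[ℂ] D) (g : B →⋆ₐ[ℂ] D) (h : ∀ a b, Commute (f a) (g b))
    (a : A) (b : B) : lift f g h (tmul a b) = f a * g b :=
  ((maxCStarSeminorm A B).lift_toCompletion (algLift f g h) (norm_le_maxCStarSeminorm _) _).trans
    (Algebra.TensorProduct.lift_tmul _ _ h a b)

theorem tmul_mul_tmul (a a' : A) (b b' : B) :
    tmul a b * tmul a' b' = tmul (a * a') (b * b') := by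
  rw [tmul, tmul, tmul, ← map_mul, Algebra.TensorProduct.tmul_mul_tmul]

variable (A B) in
/-- The canonical ⋆-homomorphism `a ↦ a ⊗ 1`. -/
noncomputable def includeLeft : A →⋆ₐ[ℂ] MaxTensor A B :=
  { (maxCStarSeminorm A B).toCompletion.toAlgHom.comp
      (Algebra.TensorProduct.includeLeft : A →ₐ[ℂ] A ⊗[ℂ] B) with
    map_star' := fun a => by
      change (maxCStarSeminorm A B).toCompletion (star a ⊗ₜ 1) =
        star ((maxCStarSeminorm A B).toCompletion (a ⊗ₜ 1))
      rw [← map_star]; simp }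

theorem includeLeft_apply (a : A) : includeLeft A B a = tmul a 1 := rfl

variable (A B) in
/-- The canonical ⋆-homomorphism `b ↦ 1 ⊗ b`. -/
noncomputable def includeRight : B →⋆ₐ[ℂ] MaxTensor A B :=
  { (maxCStarSeminorm A B).toCompletion.toAlgHom.comp
      (Algebra.TensorProduct.includeRight : B →ₐ[ℂ] A ⊗[ℂ] B) with
    map_star' := fun b => by
      change (maxCStarSeminorm A B).toCompletion (1 ⊗ₜ star b) =
        star ((maxCStarSeminorm A B).toCompletion (1 ⊗ₜ b))
      rw [← map_star]; simp }

theorem includeRight_apply (b : B) : includeRight A B b = tmul 1 b := rfl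

theorem commute_include (a : A) (b : B) : Commute (includeLeft A B a) (includeRight A B b) := by
  simp [Commute, SemiconjBy, includeLeft_apply, includeRight_apply, tmul_mul_tmul]

/-- Functoriality of the maximal tensor product in the first factor. -/
noncomputable def mapLeft (B : Type*) [CStarAlgebra B] (f : A →⋆ₐ[ℂ] A') :
    MaxTensor A B →⋆ₐ[ℂ] MaxTensor A' B :=
  lift ((includeLeft A' B).comp f) (includeRight A' B) fun a b => commute_include (f a) b

theorem mapLeft_tmul (f : A →⋆ₐ[ℂ] A') (a : A) (b : B) :
    mapLeft B f (tmul a b) = tmul (f a) b := by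
  refine (lift_tmul ((includeLeft A' B).comp f) (includeRight A' B)
    (fun a b => commute_include (f a) b) a b).trans ?_
  rw [StarAlgHom.comp_apply, includeLeft_apply, includeRight_apply, tmul_mul_tmul, mul_one, one_mul]

/-- A state on `A' ⊗ B` pulls back along a ⋆-homomorphism `A → A'`. -/
theorem exists_state_comp_mapLeft (f : A →⋆ₐ[ℂ] A') {φ : MaxTensor A' B →ₚ[ℂ] ℂ}
    (hφ : IsState φ) :
    ∃ ψ : MaxTensor A B →ₚ[ℂ] ℂ, IsState ψ ∧ ∀ a b, ψ (tmul a b) = φ (tmul (f a) b) := by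
  refine ⟨φ.comp (PositiveLinearMap.ofClass (mapLeft B f)), ?_, fun a b => ?_⟩
  · change φ (mapLeft B f 1) = 1
    rw [map_one]; exact hφ
  · change φ (mapLeft B f (tmul a b)) = _
    rw [mapLeft_tmul]

/-! ### Matrix amplification and compression to a diagonal entry -/

section Matrix

variable (n : Type*) [Fintype n] [DecidableEq n] [PartialOrder A] [StarOrderedRing A]

/-- Entrywise inclusion of matrices over `A` into matrices over `A ⊗ B`. -/
noncomputable def matrixIncludeLeft (A B : Type*) [CStarAlgebra A] [CStarAlgebra B]
    [PartialOrder A] [StarOrderedRing A] :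
    CStarMatrix n n A →⋆ₐ[ℂ] CStarMatrix n n (MaxTensor A B) :=
  { (CStarMatrix.mapₙₐ (includeLeft A B : A →⋆ₙₐ[ℂ] MaxTensor A B) :
      CStarMatrix n n A →⋆ₙₐ[ℂ] CStarMatrix n n (MaxTensor A B)) with
    map_one' := by
      ext i j
      change includeLeft A B ((1 : CStarMatrix n n A) i j) = _
      rw [CStarMatrix.one_apply, CStarMatrix.one_apply]
      split_ifs <;> simp
    commutes' c := by
      ext i j
      change includeLeft A B (algebraMap ℂ (CStarMatrix n n A) c i j) = _
      rw [CStarMatrix.algebraMap_apply, CStarMatrix.algebraMap_apply]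
      split_ifs <;> simp [AlgHomClass.commutes] }

theorem matrixIncludeLeft_apply (M : CStarMatrix n n A) (i j : n) :
    matrixIncludeLeft n A B M i j = tmul (M i j) 1 := rfl

/-- Inclusion of `B` into matrices over `A ⊗ B` as constant diagonal matrices. -/
noncomputable def matrixIncludeRight (A B : Type*) [CStarAlgebra A] [CStarAlgebra B] :
    B →⋆ₐ[ℂ] CStarMatrix n n (MaxTensor A B) where
  toFun b := CStarMatrix.ofMatrix (Matrix.diagonal fun _ => includeRight A B b)
  map_one' := by rw [map_one]; exact Matrix.diagonal_one
  map_mul' x y := by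
    rw [map_mul]
    exact (Matrix.diagonal_mul_diagonal _ _).symm
  map_zero' := by rw [map_zero]; exact Matrix.diagonal_zero
  map_add' x y := by
    rw [map_add]
    exact (Matrix.diagonal_add _ _).symm
  commutes' c := by rw [AlgHomClass.commutes]; rfl
  map_star' b := by
    rw [map_star]
    exact (Matrix.diagonal_conjTranspose _).symm

/-- A constant diagonal matrix multiplies every entry by `1 ⊗ b`, which commutes with each `M i j ⊗
1`. -/
theorem commute_matrixInclude (M : CStarMatrix n n A) (b : B) :
    Commute (matrixIncludeLeft n A B M) (matrixIncludeRight n A B b) := by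
  ext i j
  refine (Matrix.mul_diagonal (fun _ => includeRight A B b) (matrixIncludeLeft n A B M)
    i j).trans (Eq.trans ?_ (Matrix.diagonal_mul (fun _ => includeRight A B b)
    (matrixIncludeLeft n A B M) i j).symm)
  exact commute_include (M i j) b

/-- The ⋆-homomorphism `Mₙ(A) ⊗ B → Mₙ(A ⊗ B)`. -/
noncomputable def matrixHom (A B : Type*) [CStarAlgebra A] [CStarAlgebra B]
    [PartialOrder A] [StarOrderedRing A] :
    MaxTensor (CStarMatrix n n A) B →⋆ₐ[ℂ] CStarMatrix n n (MaxTensor A B) :=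
  lift (matrixIncludeLeft n A B) (matrixIncludeRight n A B) (commute_matrixInclude n)

theorem matrixHom_tmul_apply (M : CStarMatrix n n A) (b : B) (i j : n) :
    matrixHom n A B (tmul M b) i j = tmul (M i j) b := by
  rw [matrixHom, lift_tmul]
  refine (Matrix.mul_diagonal (fun _ => includeRight A B b) (matrixIncludeLeft n A B M)
    i j).trans ?_
  rw [matrixIncludeLeft_apply, includeRight_apply, tmul_mul_tmul, mul_one, one_mul]

end Matrix

end MaxTensor

/-- The entry equals `∑ j, star (N j i) * N j i`. This makes compression to a diagonal entry
positive. -/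
theorem CStarMatrix.diagEntry_star_mul_self_nonneg {n A : Type*} [Fintype n] [CStarAlgebra A]
    [PartialOrder A] [StarOrderedRing A] (N : CStarMatrix n n A) (i : n) :
    0 ≤ (star N * N) i i := by
  rw [CStarMatrix.mul_apply]
  exact Finset.sum_nonneg fun j _ => star_mul_self_nonneg (N j i)

/-- A state on `A ⊗ B` induces, through a diagonal entry, a state on `Mₙ(A) ⊗ B`. -/
theorem MaxTensor.exists_state_matrix {n A B : Type*} [Fintype n] [DecidableEq n] [CStarAlgebra A]
    [CStarAlgebra B] [PartialOrder A] [StarOrderedRing A] (i : n)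
    {φ : MaxTensor A B →ₚ[ℂ] ℂ} (hφ : IsState φ) :
    ∃ ψ : MaxTensor (CStarMatrix n n A) B →ₚ[ℂ] ℂ, IsState ψ ∧
      ∀ M b, ψ (tmul M b) = φ (tmul (M i i) b) := by
  refine ⟨PositiveLinearMap.mk₀
    { toFun := fun x => φ (matrixHom n A B x i i)
      map_add' := fun x y => by rw [map_add, ← map_add φ]; rfl
      map_smul' := fun c x => by rw [map_smul, ← map_smul φ]; rfl } fun x hx => ?_,
    ?_, fun M b => ?_⟩
  · obtain ⟨y, rfl⟩ := CStarAlgebra.nonneg_iff_eq_star_mul_self.mp hx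
    change 0 ≤ φ (matrixHom n A B (star y * y) i i)
    rw [map_mul, map_star]
    exact map_nonneg φ (CStarMatrix.diagEntry_star_mul_self_nonneg _ i)
  · change φ (matrixHom n A B 1 i i) = 1
    rw [map_one, CStarMatrix.one_apply_eq]; exact hφ
  · change φ (matrixHom n A B (tmul M b) i i) = _
    rw [matrixHom_tmul_apply]

/-! ### Naimark dilation -/

/-- The self-adjoint unitary dilating the isometry with components `s a`. -/
def naimarkUnitary {ι A : Type*} [DecidableEq ι] [Ring A] (s : ι → A) :
    Matrix (Option ι) (Option ι) A :=
  Matrix.of fun i j =>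
    match i, j with
    | none, none => 0
    | none, some b => s b
    | some a, none => s a
    | some a, some b => (if a = b then 1 else 0) - s a * s b

section

variable {ι A : Type*} [DecidableEq ι] [Ring A]

theorem naimarkUnitary_conjTranspose [StarRing A] {s : ι → A} (hs : ∀ a, star (s a) = s a) :
    (naimarkUnitary s).conjTranspose = naimarkUnitary s := by
  ext (_ | a) (_ | b)
  · exact star_zero A
  · exact hs b
  · exact hs a
  · rcases eq_or_ne a b with rfl | h
    · simp [naimarkUnitary, hs]
    · simp [naimarkUnitary, hs, h, h.symm]

/-- In block form `U = [[0, t], [s, 1 - s t]]`, where `s` is the column and `t` the row with the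
same entries. Since `t s = 1`, the product `s t` is idempotent, `t (1 - s t) = 0` and `(1 - s t) s =
0`, so `U ^ 2 = 1`. -/
theorem naimarkUnitary_mul_self [Fintype ι] {s : ι → A} (h1 : ∑ a, s a * s a = 1) :
    naimarkUnitary s * naimarkUnitary s = 1 := by
  have h2 : ∀ x, ∑ a, s a * (s a * x) = x := fun x => by
    simp_rw [← mul_assoc, ← Finset.sum_mul, h1, one_mul]
  ext (_ | a) (_ | b)
  · simpa [Matrix.mul_apply, naimarkUnitary] using h1
  · simp [Matrix.mul_apply, naimarkUnitary, mul_sub, h2]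
  · simp [Matrix.mul_apply, naimarkUnitary, sub_mul, mul_assoc, ← Finset.mul_sum, h1]
  · simp [Matrix.mul_apply, naimarkUnitary, sub_mul, mul_sub, mul_assoc, ← Finset.mul_sum, h2,
      Matrix.one_apply]

/-- **Naimark dilation** for self-adjoint `s a` with `∑ a, s a ^ 2 = 1`: the `s a ^ 2` are corners
of projections summing to one, in matrices of size one larger. -/
theorem exists_naimark_dilation [Fintype ι] [StarRing A] [Nonempty ι] {s : ι → A}
    (hs : ∀ a, star (s a) = s a) (h1 : ∑ a, s a * s a = 1) :
    ∃ P : ι → Matrix (Option ι) (Option ι) A, (∀ a, P a * P a = P a) ∧ (∀ a, star (P a) = P a) ∧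
      ∑ a, P a = 1 ∧ ∀ a, P a none none = s a * s a := by
  obtain ⟨c⟩ := ‹Nonempty ι›
  set U := naimarkUnitary s with hU
  have hUU : U * U = 1 := naimarkUnitary_mul_self h1
  have hUs : star U = U := naimarkUnitary_conjTranspose hs
  -- The extra index `none` is assigned to an arbitrary outcome `c`, so that the `E a` sum to one.
  let E : ι → Matrix (Option ι) (Option ι) A := fun a =>
    Matrix.diagonal fun i => if i.getD c = a then 1 else 0
  have hE : ∀ a, E a * E a = E a := fun a => by
    rw [Matrix.diagonal_mul_diagonal]
    congr 1; ext i; split_ifs <;> simp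
  have hEs : ∀ a, star (E a) = E a := fun a => by
    rw [Matrix.star_eq_conjTranspose, Matrix.diagonal_conjTranspose]
    congr 1; ext i; rw [Pi.star_apply]; split_ifs <;> simp
  refine ⟨fun a => U * E a * U, fun a => ?_, fun a => ?_, ?_, fun a => ?_⟩
  · calc U * E a * U * (U * E a * U) = U * E a * (U * U) * E a * U := by simp only [mul_assoc]
      _ = U * (E a * E a) * U := by rw [hUU, mul_one, mul_assoc U]
      _ = U * E a * U := by rw [hE]
  · simp only [star_mul, hUs, hEs, mul_assoc]
  · have : ∑ a, E a = 1 := by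
      ext i j
      rcases eq_or_ne i j with rfl | h
      · simp [E, Matrix.sum_apply]
      · simp [E, Matrix.sum_apply, h]
    rw [← Finset.sum_mul, ← Finset.mul_sum, this, mul_one, hUU]
  -- The choice of `c` does not affect the corner because `U none none = 0`; only the index `some a`
  -- contributes.
  · simp [Matrix.mul_apply, E, hU, naimarkUnitary, Matrix.diagonal_apply]

end
-- Change of universe
section ULift

variable (A : Type u) [CStarAlgebra A]

/-- The universe lift of a C⋆-algebra is a C⋆-algebra. -/
noncomputable abbrev CStarAlgebra.ulift : CStarAlgebra (ULift.{v} A) where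
  __ := (inferInstance : NormedRing (ULift.{v} A))
  __ := (inferInstance : NormedAlgebra ℂ (ULift.{v} A))
  star x := ⟨star x.down⟩
  star_involutive x := ULift.ext _ _ (star_star x.down)
  star_mul x y := ULift.ext _ _ (star_mul x.down y.down)
  star_add x y := ULift.ext _ _ (star_add x.down y.down)
  star_smul c x := ULift.ext _ _ (star_smul c x.down)
  norm_mul_self_le x := CStarRing.norm_mul_self_le x.down
  complete := (inferInstance : CompleteSpace (ULift.{v} A)).complete

attribute [local instance] CStarAlgebra.ulift in
/-- Projecting down from the universe lift, as a ⋆-homomorphism. -/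
noncomputable def CStarAlgebra.uliftDown : ULift.{v} A →⋆ₐ[ℂ] A where
  toFun := ULift.down
  map_one' := rfl
  map_mul' _ _ := rfl
  map_zero' := rfl
  map_add' _ _ := rfl
  commutes' _ := rfl
  map_star' _ := rfl

attribute [local instance] CStarAlgebra.ulift in
/-- The embedding into the universe lift, as a ⋆-homomorphism. -/
noncomputable def CStarAlgebra.uliftUp : A →⋆ₐ[ℂ] ULift.{v} A where
  toFun := ULift.up
  map_one' := rfl
  map_mul' _ _ := rfl
  map_zero' := rfl
  map_add' _ _ := rfl
  commutes' _ := rfl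
  map_star' _ := rfl

/-- Every C⋆-algebra has a copy in any higher universe. -/
theorem CStarAlgebra.exists_ulift : ∃ (C : Type (max u v)) (_ : CStarAlgebra C) (f : A →⋆ₐ[ℂ] C)
    (g : C →⋆ₐ[ℂ] A), ∀ x, g (f x) = x :=
  ⟨ULift.{v} A, CStarAlgebra.ulift A, CStarAlgebra.uliftUp A, CStarAlgebra.uliftDown A,
    fun _ => rfl⟩

end ULift

/-! ### Relations and universal property of `C⋆(m,k)` -/

section Universal

variable {m k : ℕ}

theorem star_freeGenerator (a : Fin k) (x : Fin m) :
    star (freeGenerator a x) = freeGenerator a x := by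
  simp [freeGenerator]

/-- Every admissible seminorm vanishes on the defining relations, hence so does their supremum, and
the completion is Hausdorff. -/
theorem generatingProjection_isPVMFamily :
    IsPVMFamily (generatingProjection : Fin k → Fin m → UniversalPVMAlgebra m k) := by
  have key : ∀ y : FreeMeasurementAlgebra m k,
      (∀ p ∈ measurementSeminorms m k, p y = 0) → (universalSeminorm m k).toCompletion y = 0 := by
    intro y hy
    rw [← norm_eq_zero, CStarSeminorm.norm_toCompletion, universalSeminorm,
      CStarSeminorm.sup_apply]
    simp [fun p : measurementSeminorms m k => hy p.1 p.2]
  refine ⟨fun a x => ⟨?_, ?_⟩, fun x => ?_⟩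
  · have := key _ fun p hp => hp.1 a x
    rw [map_sub, map_mul, sub_eq_zero] at this
    exact this
  · change star ((universalSeminorm m k).toCompletion _) = _
    rw [← map_star, star_freeGenerator]; rfl
  · have := key _ fun p hp => hp.2 x
    rw [map_sub, map_sum, map_one, sub_eq_zero] at this
    exact this

variable {A : Type*} [CStarAlgebra A]

/-- The ⋆-homomorphism on the free ⋆-algebra determined by self-adjoint elements. -/
noncomputable def freeLift (P : Fin k → Fin m → A) (hP : ∀ a x, star (P a x) = P a x) :
    FreeMeasurementAlgebra m k →⋆ₐ[ℂ] A :=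
  let g : FreeAlgebra ℝ (Fin k × Fin m) →ₐ[ℝ] A := FreeAlgebra.lift ℝ fun i => P i.1 i.2
  -- The involution reverses words and fixes the generators and the real scalars, so
  -- self-adjointness of the `P a x` suffices.
  have hg : ∀ w, g (star w) = star (g w) := fun w => by
    induction w using FreeAlgebra.induction with
    | grade0 r =>
      rw [FreeAlgebra.star_algebraMap, AlgHom.commutes, IsScalarTower.algebraMap_apply ℝ ℂ A,
        ← algebraMap_star_comm]
      simp
    | grade1 i => simp [g, hP]
    | mul u v hu hv => simp [hu, hv]
    | add u v hu hv => simp [hu, hv]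
  have hc : ∀ c w, Commute (Algebra.ofId ℂ A c) (g w) := fun c w => Algebra.commutes c (g w)
  { Algebra.TensorProduct.lift (Algebra.ofId ℂ A) g hc with
    map_star' := fun y => by
      change Algebra.TensorProduct.lift (Algebra.ofId ℂ A) g hc (star y) =
        star (Algebra.TensorProduct.lift (Algebra.ofId ℂ A) g hc y)
      induction y using TensorProduct.induction_on with
      | zero => simp
      | tmul c w =>
        rw [TensorProduct.star_tmul, Algebra.TensorProduct.lift_tmul,
          Algebra.TensorProduct.lift_tmul, star_mul, hg, Algebra.ofId_apply, Algebra.ofId_apply,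
          ← algebraMap_star_comm, Algebra.commutes]
      | add x y hx hy => rw [star_add, map_add, hx, hy, map_add, star_add] }

theorem freeLift_freeGenerator (P : Fin k → Fin m → A) (hP : ∀ a x, star (P a x) = P a x)
    (a : Fin k) (x : Fin m) : freeLift P hP (freeGenerator a x) = P a x := by
  let g : FreeAlgebra ℝ (Fin k × Fin m) →ₐ[ℝ] A := FreeAlgebra.lift ℝ fun i => P i.1 i.2
  refine (Algebra.TensorProduct.lift_tmul (Algebra.ofId ℂ A) g
    (fun c w => Algebra.commutes c (g w)) 1 (FreeAlgebra.ι ℝ (a, x))).trans ?_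
  rw [map_one, one_mul, FreeAlgebra.lift_ι_apply]

end Universal

section

variable {m k : ℕ}

/-- The universal property of `C⋆(m,k)`. -/
theorem IsPVMFamily.exists_hom {A : Type*} [CStarAlgebra A] {P : Fin k → Fin m → A}
    (hP : IsPVMFamily P) :
    ∃ f : UniversalPVMAlgebra m k →⋆ₐ[ℂ] A, ∀ a x, f (generatingProjection a x) = P a x := by
  let F := freeLift P fun a x => (hP.isStarProjection a x).isSelfAdjoint
  have hF : ∀ a x, F (freeGenerator a x) = P a x := freeLift_freeGenerator P _
  -- The PVM relations in `A` make the pulled-back seminorm admissible, so it is dominated by the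
  -- universal one.
  have hmem : CStarSeminorm.ofHom F ∈ measurementSeminorms m k := by
    refine ⟨fun a x => ?_, fun x => ?_⟩
    · rw [CStarSeminorm.ofHom_apply, map_sub, map_mul, hF,
        (hP.isStarProjection a x).isIdempotentElem.eq, sub_self, norm_zero]
    · rw [CStarSeminorm.ofHom_apply, map_sub, map_sum, map_one]
      simp only [hF, hP.sum_eq_one, sub_self, norm_zero]
  have hle : ∀ y, ‖F y‖ ≤ universalSeminorm m k y := fun y =>
    CStarSeminorm.le_sup (measurementSeminorms_bddAbove m k) hmem y
  exact ⟨(universalSeminorm m k).lift F hle, fun a x =>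
    ((universalSeminorm m k).lift_toCompletion F hle _).trans (hF a x)⟩

theorem IsPVMFamily.map {A C : Type*} [CStarAlgebra A] [CStarAlgebra C] {P : Fin k → Fin m → A}
    (hP : IsPVMFamily P) (f : A →⋆ₐ[ℂ] C) : IsPVMFamily fun a x => f (P a x) where
  isStarProjection a x := (hP.isStarProjection a x).map f
  sum_eq_one x := by rw [← map_sum, hP.sum_eq_one, map_one]

theorem IsPVMFamily.isPOVMFamily {A : Type*} [CStarAlgebra A] [PartialOrder A] [StarOrderedRing A]
    {P : Fin k → Fin m → A} (hP : IsPVMFamily P) : IsPOVMFamily P where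
  nonneg a x := (hP.isStarProjection a x).nonneg
  sum_eq_one := hP.sum_eq_one

/-- **Naimark dilation**: a family of POVMs in `A` consists of corners of a family of PVMs in
matrices over `A`. -/
theorem IsPOVMFamily.exists_dilation [Nonempty (Fin k)] {A : Type*} [CStarAlgebra A]
    [PartialOrder A] [StarOrderedRing A] {M : Fin k → Fin m → A} (hM : IsPOVMFamily M) :
    ∃ P : Fin k → Fin m → CStarMatrix (Option (Fin k)) (Option (Fin k)) A,
      IsPVMFamily P ∧ ∀ a x, P a x none none = M a x := by
  have hsq : ∀ a x, CFC.sqrt (M a x) * CFC.sqrt (M a x) = M a x := fun a x =>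
    CFC.sqrt_mul_sqrt_self _ (hM.nonneg a x)
  -- Each setting is dilated separately, but always in the same matrix algebra and with the same
  -- corner.
  have H : ∀ x, _ := fun x =>
    exists_naimark_dilation (s := fun a => CFC.sqrt (M a x))
      (fun a => (CFC.sqrt_nonneg (M a x)).isSelfAdjoint) (by simp only [hsq, hM.sum_eq_one])
  choose P hP hPs hP1 hPM using H
  exact ⟨fun a x => CStarMatrix.ofMatrix (P x a),
    ⟨fun a x => ⟨hP x a, hPs x a⟩, hP1⟩, fun a x => (hPM x a).trans (hsq a x)⟩

end

/-! ### The equivalences -/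

theorem mainTheorem8 {B : Type u} [CStarAlgebra B] [PartialOrder B] [StarOrderedRing B]
    (m k : ℕ) (σ : Fin k → Fin m → (B →ₚ[ℂ] ℂ)) :
    List.TFAE [
      ∃ φ : MaxTensor (UniversalPVMAlgebra m k) B →ₚ[ℂ] ℂ, IsState φ ∧
        ∀ a x b, σ a x b = φ (MaxTensor.tmul (generatingProjection a x) b),
      ∃ (A : Type v) (_ : CStarAlgebra A) (P : Fin k → Fin m → A)
        (φ : MaxTensor A B →ₚ[ℂ] ℂ), IsPVMFamily P ∧ IsState φ ∧
        ∀ a x b, σ a x b = φ (MaxTensor.tmul (P a x) b),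
      ∃ (A : Type v) (_ : CStarAlgebra A) (_ : PartialOrder A) (_ : StarOrderedRing A)
        (M : Fin k → Fin m → A) (φ : MaxTensor A B →ₚ[ℂ] ℂ), IsPOVMFamily M ∧ IsState φ ∧
        ∀ a x b, σ a x b = φ (MaxTensor.tmul (M a x) b)] := by
  tfae_have 1 → 2 := by
    rintro ⟨φ, hφ, hσ⟩
    -- The projections move up along `f`, while the state pulls back along its left inverse `g`.
    obtain ⟨A, _, f, g, hfg⟩ := CStarAlgebra.exists_ulift.{0, v} (UniversalPVMAlgebra m k)
    obtain ⟨ψ, hψ, h⟩ := MaxTensor.exists_state_comp_mapLeft g hφ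
    exact ⟨A, _, _, ψ, generatingProjection_isPVMFamily.map f, hψ,
      fun a x b => by rw [h, hfg, hσ]⟩
  tfae_have 2 → 3 := by
    rintro ⟨A, _, P, φ, hP, hφ, hσ⟩
    -- Positivity in condition 3 needs an order on `A`, which condition 2 does not supply.
    let _ := CStarAlgebra.spectralOrder A
    let _ := CStarAlgebra.spectralOrderedRing A
    exact ⟨A, _, _, inferInstance, P, φ, hP.isPOVMFamily, hφ, hσ⟩
  tfae_have 3 → 2 := by
    rintro ⟨A, _, _, _, M, φ, hM, hφ, hσ⟩
    rcases isEmpty_or_nonempty (Fin k) with hk | hk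
    -- With no outcomes the projection condition is vacuous, so `M` is already a PVM family.
    -- Otherwise there is an outcome to absorb the extra index in the dilation.
    · exact ⟨A, _, M, φ, ⟨isEmptyElim, hM.sum_eq_one⟩, hφ, hσ⟩
    obtain ⟨P, hP, hPM⟩ := hM.exists_dilation
    obtain ⟨ψ, hψ, h⟩ := MaxTensor.exists_state_matrix (none : Option (Fin k)) hφ
    exact ⟨_, _, P, ψ, hP, hψ, fun a x b => by rw [h, hPM, hσ]⟩
  tfae_have 2 → 1 := by
    rintro ⟨A, _, P, φ, hP, hφ, hσ⟩
    obtain ⟨f, hf⟩ := hP.exists_hom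
    obtain ⟨ψ, hψ, h⟩ := MaxTensor.exists_state_comp_mapLeft f hφ
    exact ⟨ψ, hψ, fun a x b => by rw [h, hf, hσ]⟩
  tfae_finish
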